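/- Let $n,m\ge 1$ be integers, $\ell\in\{1,\dots,n\}$ and $k\in\{1,\dots,m\}$, and let $$ M_{\ell,k} := \frac{k\binom{m}{k}}{(mn+1)\,\mathrm{B}(\ell,n-\ell+1)} \sum_{i_1=\ell}^{n}\cdots\sum_{i_{k-1}=\ell}^{n}\;\sum_{i_{k+1}=0}^{\ell-1}\cdots\sum_{i_m=0}^{\ell-1} \frac{\binom{n}{i_1}\cdots\binom{n}{i_{k-1}}\binom{n}{i_{k+1}}\cdots\binom{n}{i_m}} {\binom{mn}{i_1+\cdots+i_{k-1}+\ell+i_{k+1}+\cdots+i_m}}, $$ where $\mathrm{B}(a,b)=\int_0^1 t^{a-1}(1-t)^{b-1}\,dt$ is the Beta function. Then $M_{\ell,k}$ is the expectation of the $k$-th smallest of $m$ independent $\mathrm{Beta}(\ell,n-\ell+1)$ random variables (the mean of the corresponding Beta-Beta distribution), and $$ F_{U_{(\ell:n)}}^{-1}\!\left(\frac{k-1/2}{m+1/2}\right) < M_{\ell,k} < F_{U_{(\ell:n)}}^{-1}\!\left(\frac{k}{m+1/2}\right), $$ where $F_{U_{(\ell:n)}}^{-1}(p)=\inf\{x\in\mathbb{R}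 : F_{U_{(\ell:n)}}(x)\ge p\}$ is the quantile function of the $\mathrm{Beta}(\ell,n-\ell+1)$ distribution, whose cumulative distribution function is $F_{U_{(\ell:n)}}$. -/

import Mathlib

open MeasureTheory ProbabilityTheory

/-- The quantile function (generalized inverse of the cdf) of a law `μ` on `ℝ`:
`F_μ⁻¹(p) = inf {x | F_μ(x) ≥ p}`. -/
noncomputable def quantileFn (μ : Measure ℝ) (p : ℝ) : ℝ :=
  sInf {x : ℝ | p ≤ cdf μ x}

/-- The order statistics of a sample `x` of size `N`: the values of `x` listed in nondecreasing
order. As indices start at `0`, the `r`-th smallest value is `orderStat x ⟨r - 1, _⟩`. -/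
noncomputable def orderStat {N : ℕ} (x : Fin N → ℝ) (r : Fin N) : ℝ :=
  x (Tuple.sort x r)

/-- The law `Beta(ℓ, n - ℓ + 1)` of the `ℓ`-th order statistic of `n` i.i.d. uniform variables. -/
noncomputable def betaOrderLaw (n ℓ : ℕ) : Measure ℝ :=
  betaMeasure (ℓ : ℝ) ((n : ℝ) - ℓ + 1)

/-- The quantity `M_{ℓ,k}`, for `1 ≤ ℓ ≤ n` and `1 ≤ k ≤ m`. The tuple `a` stands for
`(i_1, …, i_{k-1})`, with entries in `{ℓ, …, n}`, and `b` for `(i_{k+1}, …, i_m)`, with entries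
in `{0, …, ℓ - 1}`. -/
noncomputable def coverageM (n m ℓ k : ℕ) : ℝ :=
  ((k : ℝ) * (m.choose k : ℝ) *
      ∑ a ∈ Fintype.piFinset (fun _ : Fin (k - 1) => Finset.Icc ℓ n),
        ∑ b ∈ Fintype.piFinset (fun _ : Fin (m - k) => Finset.range ℓ),
          ((∏ j, (n.choose (a j) : ℝ)) * ∏ j, (n.choose (b j) : ℝ)) /
            ((m * n).choose ((∑ j, a j) + ℓ + ∑ j, b j) : ℝ)) /
    (((m : ℝ) * n + 1) * beta (ℓ : ℝ) ((n : ℝ) - ℓ + 1))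

/-! Put `F = 1 - binomTail n ℓ`, the cdf of Beta(ℓ, n-ℓ+1) on [0,1], and `f = orderDensity n ℓ`. The
k-th smallest X of m draws exceeds t exactly when fewer than k draws fall below t, so E X = ∫₀¹
`binomTail m k (F t)` dt. Integrating by parts and expanding the powers of F and 1 - F into
monomials gives the closed form (`coverageM_eq_integral`).

The upper bound is Jensen's inequality for the cumulative hazard Λ = -log(1 - F). It is convex
because f/(1 - F) is nondecreasing (`orderDensity_mul_binomTail_le`). It turns the draws into
standard exponentials, so E Λ(X) = ∑_{j<k} 1/(m-j). If F(c) = k/(m+1/2), this sum is strictly below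
Λ(c) (`sum_inv_lt_log`), while E Λ(X) ≥ Λ(c) + Λ'(c)(E X - c) by the tangent line at c; hence E X <
c. `integral_binomTail_comp_lt` runs this argument with integrals of survival functions. The lower
bound follows under t ↦ 1 - t, k ↦ m + 1 - k. -/

/-! ### Binomial tails and densities of uniform order statistics. -/

/-- The probability that a binomial variable with parameters `n` and `p` is less than `k`. -/
noncomputable def binomTail (n k : ℕ) (p : ℝ) : ℝ :=
  ∑ j ∈ Finset.range k, (n.choose j : ℝ) * p ^ j * (1 - p) ^ (n - j)

/-- The density of the `k`-th order statistic of `n` independent uniform variables. -/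
noncomputable def orderDensity (n k : ℕ) (p : ℝ) : ℝ :=
  k * (n.choose k : ℝ) * p ^ (k - 1) * (1 - p) ^ (n - k)

lemma orderDensity_succ (n k : ℕ) (p : ℝ) : orderDensity n (k + 1) p =
    (k + 1) * (n.choose (k + 1) : ℝ) * p ^ k * (1 - p) ^ (n - (k + 1)) := by
  simp [orderDensity]

/-- The derivatives of successive binomial terms telescope, leaving one term. -/
lemma hasDerivAt_binomTail (n k : ℕ) (p : ℝ) :
    HasDerivAt (binomTail n k) (-orderDensity n k p) p := by
  induction k with
  | zero =>
    have : binomTail n 0 = fun _ => 0 := by ext; simp [binomTail]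
    rw [this]
    simpa [orderDensity] using hasDerivAt_const p (0 : ℝ)
  | succ k ih =>
    have h : binomTail n (k + 1) =
        fun p => binomTail n k p + (n.choose k : ℝ) * p ^ k * (1 - p) ^ (n - k) := by
      ext q; simp [binomTail, Finset.sum_range_succ]
    rw [h]
    have h1 : HasDerivAt (fun p : ℝ => (1 - p) ^ (n - k))
        ((n - k : ℕ) * (1 - p) ^ (n - k - 1) * (-1)) p :=
      ((hasDerivAt_id p).const_sub 1).pow (n - k)
    have h2 := ih.fun_add (((hasDerivAt_pow k p).const_mul (n.choose k : ℝ)).fun_mul h1)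
    refine h2.congr_deriv ?_
    have h3 : ((n.choose (k + 1) : ℝ)) * (k + 1) = n.choose k * ((n - k : ℕ) : ℝ) := by
      exact_mod_cast Nat.choose_succ_right_eq n k
    have h4 : n - (k + 1) = n - k - 1 := by omega
    rw [orderDensity_succ, orderDensity, h4]
    linear_combination (p ^ k * (1 - p) ^ (n - k - 1)) * h3

lemma continuous_binomTail (n k : ℕ) : Continuous (binomTail n k) := by
  unfold binomTail; fun_prop

lemma continuous_orderDensity (n k : ℕ) : Continuous (orderDensity n k) := by
  unfold orderDensity; fun_prop

lemma binomTail_zero (n : ℕ) {k : ℕ} (hk : 1 ≤ k) : binomTail n k 0 = 1 := by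
  obtain ⟨k, rfl⟩ := Nat.exists_eq_add_of_le' hk
  simp [binomTail, Finset.sum_range_succ']

lemma binomTail_one {n k : ℕ} (hk : k ≤ n) : binomTail n k 1 = 0 := by
  refine Finset.sum_eq_zero fun j hj => ?_
  have : n - j ≠ 0 := by have := Finset.mem_range.1 hj; omega
  simp [this]

lemma binomTail_add_sum_Icc (n : ℕ) {k : ℕ} (hk : k ≤ n) (p : ℝ) :
    binomTail n k p +
      ∑ j ∈ Finset.Icc k n, (n.choose j : ℝ) * p ^ j * (1 - p) ^ (n - j) = 1 := by
  have h : Finset.Icc k n = Finset.Ico k (n + 1) := by ext; simp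
  have := (add_pow p (1 - p) n).symm
  rw [add_sub_cancel, one_pow] at this
  rw [h, binomTail, Finset.sum_range_add_sum_Ico _ (by omega)]
  refine Eq.trans ?_ this
  exact Finset.sum_congr rfl fun j _ => mul_rotate _ _ _

/-- Exchanging successes and failures; this drives every reflection argument below. -/
lemma binomTail_one_sub {n k : ℕ} (hk : k ≤ n) (p : ℝ) :
    binomTail n (n + 1 - k) (1 - p) = 1 - binomTail n k p := by
  rw [← eq_sub_of_add_eq' (binomTail_add_sum_Icc n hk p), binomTail]
  refine Finset.sum_nbij' (fun j => n - j) (fun j => n - j) ?_ ?_ ?_ ?_ ?_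
  · intro j hj; simp at hj ⊢; omega
  · intro j hj; simp at hj ⊢; omega
  · intro j hj; simp at hj ⊢; omega
  · intro j hj; simp at hj ⊢; omega
  · intro j hj
    have hj' : j ≤ n := by have := Finset.mem_range.1 hj; omega
    rw [Nat.choose_symm hj', Nat.sub_sub_self hj', sub_sub_cancel]
    ring

lemma binomTail_le_one {n k : ℕ} (hk : k ≤ n) {p : ℝ} (h0 : 0 ≤ p) (h1 : p ≤ 1) :
    binomTail n k p ≤ 1 := by
  have h : 0 ≤ 1 - p := by linarith
  rw [← binomTail_add_sum_Icc n hk p]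
  exact le_add_of_nonneg_right (Finset.sum_nonneg fun j _ => by positivity)

lemma orderDensity_pos {n k : ℕ} (hk : 1 ≤ k) (hkn : k ≤ n) {p : ℝ} (h0 : 0 < p) (h1 : p < 1) :
    0 < orderDensity n k p := by
  have h : 0 < 1 - p := by linarith
  have := Nat.choose_pos hkn
  unfold orderDensity
  positivity

lemma orderDensity_nonneg (n k : ℕ) {p : ℝ} (h0 : 0 ≤ p) (h1 : p ≤ 1) :
    0 ≤ orderDensity n k p := by
  have h : 0 ≤ 1 - p := by linarith
  unfold orderDensity
  positivity

lemma strictAntiOn_binomTail {n k : ℕ} (hk : 1 ≤ k) (hkn : k ≤ n) :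
    StrictAntiOn (binomTail n k) (Set.Icc 0 1) := by
  refine strictAntiOn_of_deriv_neg (convex_Icc 0 1) (continuous_binomTail n k).continuousOn ?_
  intro x hx
  rw [interior_Icc] at hx
  rw [(hasDerivAt_binomTail n k x).deriv]
  linarith [orderDensity_pos hk hkn hx.1 hx.2]

/-- The hazard rate of an order statistic of uniform variables is nondecreasing. -/
lemma orderDensity_mul_binomTail_le (n k : ℕ) {s t : ℝ} (hs : 0 ≤ s) (hst : s ≤ t) (ht : t ≤ 1)
    (hkn : k ≤ n) :
    orderDensity n k s * binomTail n k t ≤ orderDensity n k t * binomTail n k s := by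
  simp only [binomTail, Finset.mul_sum]
  refine Finset.sum_le_sum fun j hj => ?_
  obtain ⟨d, rfl⟩ : ∃ d, k = j + d + 1 := by
    have := Finset.mem_range.1 hj; exact ⟨k - j - 1, by omega⟩
  obtain ⟨e, rfl⟩ : ∃ e, n = j + d + 1 + e := Nat.exists_eq_add_of_le hkn
  have e1 : j + d + 1 + e - (j + d + 1) = e := by omega
  have e2 : j + d + 1 + e - j = e + (d + 1) := by omega
  have h1 : 0 ≤ 1 - t := by linarith
  have h2 : 0 ≤ 1 - s := by linarith
  have h0 : 0 ≤ t := by linarith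
  -- With d = k - 1 - j, the j-th tail term over the density is a constant times (1-p)^(d+1) / p^d,
  -- which decreases in p; the comparison is therefore termwise.
  have key : s ^ d * (1 - t) ^ (d + 1) ≤ t ^ d * (1 - s) ^ (d + 1) := by gcongr
  set A : ℝ := (j + d + 1 : ℕ) * ((j + d + 1 + e).choose (j + d + 1) : ℝ) *
    ((j + d + 1 + e).choose j : ℝ) * s ^ j * t ^ j * (1 - s) ^ e * (1 - t) ^ e with hA
  have hA0 : 0 ≤ A := by positivity
  have := mul_le_mul_of_nonneg_left key hA0
  simp only [orderDensity, e1, e2, Nat.add_sub_cancel, pow_add]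
  rw [hA] at this
  convert this using 1 <;> ring

/-! ### Exact integrals and the harmonic-sum estimate. -/

/-- The integrand has antiderivative `-binomTail m k ∘ F`, so no monotonicity of F is needed. With F
the identity it yields the Beta integrals; with F a cdf, the mean cumulative hazard. -/
lemma integral_orderDensity_comp {m k : ℕ} (hk : 1 ≤ k) (hkm : k ≤ m) {F f : ℝ → ℝ}
    (hF : ∀ t, HasDerivAt F (f t) t) (hf : Continuous f) (hF0 : F 0 = 0) (hF1 : F 1 = 1) :
    ∫ t in (0 : ℝ)..1, orderDensity m k (F t) * f t = 1 := by
  have hFc : Continuous F := continuous_iff_continuousAt.2 fun t => (hF t).continuousAt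
  have h := intervalIntegral.integral_eq_sub_of_hasDerivAt (a := 0) (b := 1)
    (f := fun t => -binomTail m k (F t)) (f' := fun t => orderDensity m k (F t) * f t)
    (fun t _ => by
      simpa using ((hasDerivAt_binomTail m k (F t)).comp t (hF t)).fun_neg)
    (((continuous_orderDensity m k).comp hFc |>.mul hf).intervalIntegrable _ _)
  rw [h, hF0, hF1, binomTail_zero m hk, binomTail_one hkm]
  norm_num

lemma integral_pow_mul_one_sub_pow {N i : ℕ} (hi : i ≤ N) :
    ∫ t in (0 : ℝ)..1, t ^ i * (1 - t) ^ (N - i) = 1 / (((N : ℝ) + 1) * N.choose i) := by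
  have h := integral_orderDensity_comp (m := N + 1) (k := i + 1) (by omega) (by omega)
    (F := fun t => t) (f := fun _ => 1) (fun t => hasDerivAt_id t) continuous_const rfl rfl
  have h1 : ((N + 1 : ℝ) * N.choose i) = (N + 1).choose (i + 1) * (i + 1) := by
    exact_mod_cast Nat.add_one_mul_choose_eq N i
  have h2 : 0 < (N.choose i : ℝ) := by exact_mod_cast Nat.choose_pos hi
  have h3 : ∀ t : ℝ, orderDensity (N + 1) (i + 1) t * 1 =
      ((N + 1 : ℝ) * N.choose i) * (t ^ i * (1 - t) ^ (N - i)) := by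
    intro t
    rw [h1, orderDensity_succ, Nat.add_sub_add_right]
    ring
  simp only [h3, intervalIntegral.integral_const_mul] at h
  rw [eq_div_iff (by positivity), mul_comm, h]

/-- Source of the 1/2 in the quantile orders: 1/x < log((x+1/2)/(x-1/2)) telescopes over x = m, …,
m-k+1. The one-step bound is log(1+y) > 2y/(y+2) at y = 1/(x-1/2). -/
lemma sum_inv_lt_log (m k : ℕ) (hk : 1 ≤ k) (hkm : k ≤ m) :
    ∑ j ∈ Finset.range k, 1 / ((m : ℝ) - j) <
      Real.log ((m + 1 / 2) / (m - k + 1 / 2)) := by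
  have step : ∀ x : ℝ, 1 ≤ x → 1 / x < Real.log ((x + 1 / 2) / (x - 1 / 2)) := by
    intro x hx
    have hx' : 0 < x - 1 / 2 := by linarith
    have h := Real.lt_log_one_add_of_pos (x := 1 / (x - 1 / 2)) (by positivity)
    have e1 : 1 + 1 / (x - 1 / 2) = (x + 1 / 2) / (x - 1 / 2) := by
      rw [eq_div_iff hx'.ne', add_mul, div_mul_cancel₀ _ hx'.ne']; ring
    have e2 : 2 * (1 / (x - 1 / 2)) / (1 / (x - 1 / 2) + 2) = 1 / x := by
      have : 1 / (x - 1 / 2) + 2 = 2 * x / (x - 1 / 2) := by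
        rw [eq_div_iff hx'.ne', add_mul, div_mul_cancel₀ _ hx'.ne']; ring
      rw [this]
      have : x ≠ 0 := by linarith
      have := hx'.ne'
      generalize x - 1 / 2 = y at *
      field_simp
    rwa [e1, e2] at h
  induction k, hk using Nat.le_induction with
  | base =>
    have h1 : (1 : ℝ) ≤ m := by exact_mod_cast hkm
    have := step m h1
    simp only [Finset.sum_range_one, Nat.cast_zero, sub_zero, Nat.cast_one]
    convert this using 3
    ring
  | succ k hk ih =>
    have h1 : (k : ℝ) + 1 ≤ m := by exact_mod_cast hkm
    rw [Finset.sum_range_succ]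
    have h2 := ih (by omega)
    have h3 := step (m - k) (by linarith)
    have p1 : (0 : ℝ) < m + 1 / 2 := by positivity
    have p2 : (0 : ℝ) < m - k + 1 / 2 := by linarith
    have p3 : (0 : ℝ) < m - k - 1 / 2 := by linarith
    have e : ((m : ℝ) - (k + 1 : ℕ) + 1 / 2) = m - k - 1 / 2 := by push_cast; ring
    rw [e]
    rw [Real.log_div p1.ne' p2.ne'] at h2
    rw [Real.log_div p2.ne' p3.ne'] at h3
    rw [Real.log_div p1.ne' p3.ne']
    linarith

/-! ### Means of order statistics against quantiles. -/

/-- If `F` has nondecreasing hazard rate, the mean of the `k`-th order statistic of a sample of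
size `m` is less than the quantile of `F` of order `k / (m + 1 / 2)`. -/
lemma integral_binomTail_comp_lt {m k : ℕ} (hk : 1 ≤ k) (hkm : k ≤ m) {F f : ℝ → ℝ}
    (hF : ∀ t, HasDerivAt F (f t) t) (hf : Continuous f) (hF0 : F 0 = 0) (hF1 : F 1 = 1)
    (hpos : ∀ t, 0 < t → t < 1 → 0 < f t) (hnn : ∀ t, 0 ≤ t → t ≤ 1 → 0 ≤ f t)
    (haz : ∀ s t, 0 ≤ s → s ≤ t → t ≤ 1 → f s * (1 - F t) ≤ f t * (1 - F s))
    {c : ℝ} (hc0 : 0 < c) (hc1 : c < 1) (hc : F c = k / (m + 1 / 2)) :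
    ∫ t in (0 : ℝ)..1, binomTail m k (F t) < c := by
  have hFc : Continuous F := continuous_iff_continuousAt.2 fun t => (hF t).continuousAt
  have hmono : MonotoneOn F (Set.Icc 0 1) := by
    refine monotoneOn_of_deriv_nonneg (convex_Icc 0 1) hFc.continuousOn
      (fun t _ => (hF t).differentiableAt.differentiableWithinAt) fun t ht => ?_
    rw [interior_Icc] at ht
    rw [(hF t).deriv]
    exact hnn t ht.1.le ht.2.le
  have hFnn : ∀ t, 0 ≤ t → t ≤ 1 → 0 ≤ F t := fun t h0 h1 =>
    hF0 ▸ hmono (by simp) ⟨h0, h1⟩ h0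
  have hFle : ∀ t, 0 ≤ t → t ≤ 1 → F t ≤ 1 := fun t h0 h1 =>
    hF1 ▸ hmono ⟨h0, h1⟩ (by simp) h1
  have hkm' : (k : ℝ) ≤ m := by exact_mod_cast hkm
  have hFc1 : F c < 1 := by
    rw [hc, div_lt_one (by positivity)]; linarith
  have hSc : 0 < 1 - F c := by linarith
  have hFlt : ∀ t, 0 ≤ t → t ≤ c → F t < 1 := fun t h0 h1 =>
    (hmono ⟨h0, by linarith⟩ ⟨hc0.le, hc1.le⟩ h1).trans_lt hFc1
  -- H is G · f/(1-F) with the factor 1 - F cancelled, so that it stays continuous at t = 1.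
  set H : ℝ → ℝ := fun t => ∑ j ∈ Finset.range k,
    (m.choose j : ℝ) * F t ^ j * (1 - F t) ^ (m - 1 - j) * f t with hH
  set G : ℝ → ℝ := fun t => binomTail m k (F t) with hG
  have hHc : Continuous H := by rw [hH]; fun_prop
  have hGc : Continuous G := (continuous_binomTail m k).comp hFc
  have hHG : ∀ t, (1 - F t) * H t = G t * f t := by
    intro t
    simp only [hH, hG, binomTail, Finset.mul_sum, Finset.sum_mul]
    refine Finset.sum_congr rfl fun j hj => ?_
    have : m - j = m - 1 - j + 1 := by have := Finset.mem_range.1 hj; omega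
    rw [this, pow_succ]; ring
  set r : ℝ := f c / (1 - F c) with hr
  have hr0 : 0 < r := div_pos (hpos c hc0 hc1) hSc
  -- Each summand of H is the density of the (j+1)-th order statistic divided by m - j.
  have intH : ∫ t in (0 : ℝ)..1, H t = ∑ j ∈ Finset.range k, 1 / ((m : ℝ) - j) := by
    rw [hH, intervalIntegral.integral_finsetSum fun j _ => by
      apply Continuous.intervalIntegrable; fun_prop]
    refine Finset.sum_congr rfl fun j hj => ?_
    have hj' : j + 1 ≤ m := by have := Finset.mem_range.1 hj; omega
    have hpos : (0 : ℝ) < m - j := by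
      have : (j : ℝ) + 1 ≤ m := by exact_mod_cast hj'
      linarith
    have h := integral_orderDensity_comp (m := m) (k := j + 1) (by omega) hj' hF hf hF0 hF1
    have h3 : ((m.choose (j + 1) : ℝ)) * (j + 1) = m.choose j * ((m : ℝ) - j) := by
      rw [← Nat.cast_sub (by omega)]
      exact_mod_cast Nat.choose_succ_right_eq m j
    have h4 : ∀ t, orderDensity m (j + 1) (F t) * f t =
        ((m : ℝ) - j) * ((m.choose j : ℝ) * F t ^ j * (1 - F t) ^ (m - 1 - j) * f t) := by
      intro t
      have : m - (j + 1) = m - 1 - j := by omega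
      rw [orderDensity_succ, this]
      linear_combination (F t ^ j * (1 - F t) ^ (m - 1 - j) * f t) * h3
    simp only [h4, intervalIntegral.integral_const_mul] at h
    rw [eq_div_iff hpos.ne', mul_comm, h]
  have hquot : ContinuousOn (fun t => f t / (1 - F t)) (Set.uIcc 0 c) := by
    refine hf.continuousOn.div (by fun_prop) fun t ht => ?_
    rw [Set.uIcc_of_le hc0.le] at ht
    linarith [hFlt t ht.1 ht.2]
  have intL : ∫ t in (0 : ℝ)..c, f t / (1 - F t) = -Real.log (1 - F c) := by
    rw [intervalIntegral.integral_eq_sub_of_hasDerivAt (f := fun t => -Real.log (1 - F t))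
      _ hquot.intervalIntegrable]
    · simp [hF0]
    · intro t ht
      rw [Set.uIcc_of_le hc0.le] at ht
      have : 1 - F t ≠ 0 := by linarith [hFlt t ht.1 ht.2]
      simpa [neg_div] using (((hF t).const_sub 1).log this).fun_neg
  -- The integrand is (f/(1-F) - r)(G - 1), a product of two nonpositive factors before c.
  have left : 0 ≤ ∫ t in (0 : ℝ)..c, (H t - f t / (1 - F t) - r * G t + r) := by
    refine intervalIntegral.integral_nonneg hc0.le fun t ht => ?_
    have hp : 0 < 1 - F t := by linarith [hFlt t ht.1 ht.2]
    have e : H t = G t * (f t / (1 - F t)) := by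
      rw [← mul_div_assoc, ← hHG t, mul_div_cancel_left₀ _ hp.ne']
    have hle : f t / (1 - F t) ≤ r := by
      rw [hr, div_le_div_iff₀ hp hSc]
      exact haz t c ht.1 ht.2 hc1.le
    have hG1 : G t ≤ 1 := binomTail_le_one hkm (hFnn t ht.1 (by linarith [ht.2]))
      (hFle t ht.1 (by linarith [ht.2]))
    rw [e]
    nlinarith [mul_nonneg (sub_nonneg.2 hle) (sub_nonneg.2 hG1)]
  -- Formally (f/(1-F) - r)G; the sign is checked term by term, since 1 - F vanishes at t = 1.
  have right : 0 ≤ ∫ t in c..(1 : ℝ), (H t - r * G t) := by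
    refine intervalIntegral.integral_nonneg hc1.le fun t ht => ?_
    have ht0 : 0 ≤ t := by linarith [ht.1]
    have h1 : r * (1 - F t) ≤ f t := by
      rw [hr, div_mul_eq_mul_div, div_le_iff₀ hSc]
      exact haz c t hc0.le ht.1 ht.2
    have h2 : 0 ≤ F t := hFnn t ht0 ht.2
    have h3 : 0 ≤ 1 - F t := by linarith [hFle t ht0 ht.2]
    simp only [hH, hG, binomTail, Finset.mul_sum, ← Finset.sum_sub_distrib]
    refine Finset.sum_nonneg fun j hj => ?_
    have : m - j = m - 1 - j + 1 := by have := Finset.mem_range.1 hj; omega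
    have h4 := mul_le_mul_of_nonneg_left h1
      (show 0 ≤ (m.choose j : ℝ) * F t ^ j * (1 - F t) ^ (m - 1 - j) by positivity)
    rw [this, pow_succ]
    nlinarith [h4]
  have iH : ∀ a b, IntervalIntegrable H volume a b := fun a b => hHc.intervalIntegrable a b
  have iG : ∀ a b, IntervalIntegrable (fun t => r * G t) volume a b :=
    fun a b => (hGc.const_mul r).intervalIntegrable a b
  have eleft : ∫ t in (0 : ℝ)..c, (H t - f t / (1 - F t) - r * G t + r) =
      (∫ t in (0 : ℝ)..c, H t) + Real.log (1 - F c) - r * (∫ t in (0 : ℝ)..c, G t) + r * c := by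
    rw [intervalIntegral.integral_add
        (((iH _ _).sub hquot.intervalIntegrable).sub (iG _ _)) intervalIntegrable_const,
      intervalIntegral.integral_sub ((iH _ _).sub hquot.intervalIntegrable) (iG _ _),
      intervalIntegral.integral_sub (iH _ _) hquot.intervalIntegrable, intL,
      intervalIntegral.integral_const_mul, intervalIntegral.integral_const]
    simp; ring
  have eright : ∫ t in c..(1 : ℝ), (H t - r * G t) =
      (∫ t in c..(1 : ℝ), H t) - r * ∫ t in c..(1 : ℝ), G t := by
    rw [intervalIntegral.integral_sub (iH _ _) (iG _ _), intervalIntegral.integral_const_mul]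
  have sH := intervalIntegral.integral_add_adjacent_intervals (iH 0 c) (iH c 1)
  have sG := intervalIntegral.integral_add_adjacent_intervals
    (hGc.intervalIntegrable (μ := volume) 0 c) (hGc.intervalIntegrable c 1)
  have hlog := sum_inv_lt_log m k hk hkm
  have elog : Real.log ((m + 1 / 2) / (m - k + 1 / 2)) = -Real.log (1 - F c) := by
    rw [← Real.log_inv, hc]
    congr 1
    have p1 : (0 : ℝ) < m + 1 / 2 := by positivity
    rw [one_sub_div p1.ne', inv_div]
    congr 1; ring
  rw [elog, ← intH] at hlog
  -- Adding `left` and `right` gives r∫G ≤ rc + ∫H + log(1 - F c); strictness comes from `hlog`.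
  have : r * (∫ t in (0 : ℝ)..1, G t) < r * c := by
    rw [← sG]
    rw [eleft] at left
    rw [eright] at right
    linarith
  exact lt_of_mul_lt_mul_left this hr0.le

/-- The reflection of `integral_binomTail_comp_lt`. -/
lemma lt_integral_binomTail_comp {m k : ℕ} (hk : 1 ≤ k) (hkm : k ≤ m) {F f : ℝ → ℝ}
    (hF : ∀ t, HasDerivAt F (f t) t) (hf : Continuous f) (hF0 : F 0 = 0) (hF1 : F 1 = 1)
    (hpos : ∀ t, 0 < t → t < 1 → 0 < f t) (hnn : ∀ t, 0 ≤ t → t ≤ 1 → 0 ≤ f t)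
    (haz : ∀ s t, 0 ≤ s → s ≤ t → t ≤ 1 → f t * F s ≤ f s * F t)
    {c : ℝ} (hc0 : 0 < c) (hc1 : c < 1) (hc : F c = (k - 1 / 2) / (m + 1 / 2)) :
    c < ∫ t in (0 : ℝ)..1, binomTail m k (F t) := by
  have hFc : Continuous F := continuous_iff_continuousAt.2 fun t => (hF t).continuousAt
  -- The orders match because 1 - (k-1/2)/(m+1/2) = (m+1-k)/(m+1/2).
  have h := integral_binomTail_comp_lt (m := m) (k := m + 1 - k) (by omega) (by omega)
    (F := fun t => 1 - F (1 - t)) (f := fun t => f (1 - t))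
    (fun t => by
      simpa using (HasDerivAt.scomp t (hF (1 - t)) ((hasDerivAt_id t).const_sub 1)).const_sub 1)
    (by fun_prop) (by simp [hF1]) (by simp [hF0])
    (fun t h0 h1 => hpos _ (by linarith) (by linarith))
    (fun t h0 h1 => hnn _ (by linarith) (by linarith))
    (fun s t h0 h1 h2 => by
      simpa using haz (1 - t) (1 - s) (by linarith) (by linarith) (by linarith))
    (c := 1 - c) (by linarith) (by linarith)
    (by
      have p1 : (0 : ℝ) < m + 1 / 2 := by positivity
      rw [sub_sub_cancel, hc, Nat.cast_sub (by omega), one_sub_div p1.ne']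
      push_cast
      congr 1; ring)
  simp only [binomTail_one_sub hkm] at h
  rw [intervalIntegral.integral_comp_sub_left (fun t => 1 - binomTail m k (F t)) 1] at h
  rw [sub_self, sub_zero, intervalIntegral.integral_sub intervalIntegrable_const
    (Continuous.intervalIntegrable (by have := continuous_binomTail m k; fun_prop) _ _)] at h
  simp at h
  linarith

/-! ### Reflected densities and the reversed hazard rate. -/

lemma orderDensity_one_sub {n k : ℕ} (hk : 1 ≤ k) (hkn : k ≤ n) (p : ℝ) :
    orderDensity n (n + 1 - k) (1 - p) = orderDensity n k p := by
  obtain ⟨d, rfl⟩ := Nat.exists_eq_add_of_le' hk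
  obtain ⟨e, rfl⟩ := Nat.exists_eq_add_of_le hkn
  have h : ((e + 1 : ℕ) : ℝ) * ((d + 1 + e).choose (e + 1) : ℝ) =
      (d + 1 : ℕ) * ((d + 1 + e).choose (d + 1) : ℝ) := by
    have h1 := Nat.choose_succ_right_eq (d + 1 + e) d
    rw [Nat.choose_symm_of_eq_add (show d + 1 + e = d + (e + 1) by omega),
      show d + 1 + e - d = e + 1 by omega] at h1
    rw [mul_comm, mul_comm ((d + 1 : ℕ) : ℝ)]
    exact_mod_cast h1.symm
  have e1 : d + 1 + e + 1 - (d + 1) = e + 1 := by omega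
  have e2 : d + 1 + e - (e + 1) = d := by omega
  have e3 : d + 1 + e - (d + 1) = e := by omega
  rw [orderDensity, orderDensity, e1, e2, e3, h, sub_sub_cancel, add_tsub_cancel_right,
    add_tsub_cancel_right]
  ring

/-- The reversed hazard rate of an order statistic of uniform variables is nonincreasing. -/
lemma orderDensity_mul_one_sub_binomTail_le (n k : ℕ) {s t : ℝ} (hs : 0 ≤ s) (hst : s ≤ t)
    (ht : t ≤ 1) (hk : 1 ≤ k) (hkn : k ≤ n) :
    orderDensity n k t * (1 - binomTail n k s) ≤ orderDensity n k s * (1 - binomTail n k t) := by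
  have h := orderDensity_mul_binomTail_le n (n + 1 - k) (s := 1 - t) (t := 1 - s)
    (by linarith) (by linarith) (by linarith) (by omega)
  simpa only [orderDensity_one_sub hk hkn, binomTail_one_sub hkn] using h

/-! ### The Beta law: density, cdf and quantiles. -/

lemma continuous_one_sub_binomTail (n ℓ : ℕ) : Continuous fun t => 1 - binomTail n ℓ t :=
  continuous_const.sub (continuous_binomTail n ℓ)

lemma beta_natCast {n ℓ : ℕ} (hℓ : 1 ≤ ℓ) (hℓn : ℓ ≤ n) :
    beta (ℓ : ℝ) ((n : ℝ) - ℓ + 1) = 1 / (ℓ * (n.choose ℓ : ℝ)) := by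
  obtain ⟨d, rfl⟩ := Nat.exists_eq_add_of_le' hℓ
  obtain ⟨e, rfl⟩ := Nat.exists_eq_add_of_le hℓn
  have h1 : Real.Gamma ((d + 1 : ℕ) : ℝ) = d.factorial := by
    push_cast; exact Real.Gamma_nat_eq_factorial d
  have e2 : ((d + 1 + e : ℕ) : ℝ) - (d + 1 : ℕ) + 1 = e + 1 := by push_cast; ring
  have e3 : ((d + 1 : ℕ) : ℝ) + (e + 1) = (d + 1 + e : ℕ) + 1 := by push_cast; ring
  have hc : ((d + 1 + e).choose (d + 1) : ℝ) * ((d + 1 : ℕ) * d.factorial) * e.factorial =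
      (d + 1 + e).factorial := by
    have := Nat.choose_mul_factorial_mul_factorial (show d + 1 ≤ d + 1 + e by omega)
    rw [Nat.add_sub_cancel_left] at this
    rw [Nat.factorial_succ d] at this
    exact_mod_cast this
  have p1 : ((d + 1 + e).choose (d + 1) : ℝ) ≠ 0 := by
    exact_mod_cast (Nat.choose_pos (by omega)).ne'
  have p2 : ((d + 1 : ℕ) : ℝ) ≠ 0 := by exact_mod_cast d.succ_ne_zero
  rw [beta, e2, e3, h1, Real.Gamma_nat_eq_factorial, Real.Gamma_nat_eq_factorial,
    div_eq_div_iff (by positivity) (mul_ne_zero p2 p1), ← hc]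
  ring

lemma betaOrderLaw_eq {n ℓ : ℕ} (hℓ : 1 ≤ ℓ) (hℓn : ℓ ≤ n) :
    betaOrderLaw n ℓ = (volume.restrict (Set.Ioo 0 1)).withDensity
      (fun x => ENNReal.ofReal (orderDensity n ℓ x)) := by
  rw [betaOrderLaw, betaMeasure, ← withDensity_indicator measurableSet_Ioo]
  congr 1
  ext x
  by_cases hx : x ∈ Set.Ioo (0 : ℝ) 1
  · rw [Set.indicator_of_mem hx, betaPDF_of_pos_lt_one hx.1 hx.2, beta_natCast hℓ hℓn,
      orderDensity, one_div_one_div]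
    have e1 : (ℓ : ℝ) - 1 = (ℓ - 1 : ℕ) := by push_cast [hℓ]; ring
    have e2 : (n : ℝ) - ℓ + 1 - 1 = (n - ℓ : ℕ) := by push_cast [hℓn]; ring
    rw [e1, e2, Real.rpow_natCast, Real.rpow_natCast]
  · rw [Set.indicator_of_notMem hx, betaPDF_eq, if_neg (by simpa using hx), ENNReal.ofReal_zero]

lemma isProbabilityMeasure_betaOrderLaw {n ℓ : ℕ} (hℓ : 1 ≤ ℓ) (hℓn : ℓ ≤ n) :
    IsProbabilityMeasure (betaOrderLaw n ℓ) := by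
  have h1 : (1 : ℝ) ≤ ℓ := by exact_mod_cast hℓ
  have h2 : (ℓ : ℝ) ≤ n := by exact_mod_cast hℓn
  exact isProbabilityMeasureBeta (by linarith) (by linarith)

lemma ae_betaOrderLaw_mem {n ℓ : ℕ} (hℓ : 1 ≤ ℓ) (hℓn : ℓ ≤ n) :
    ∀ᵐ x ∂betaOrderLaw n ℓ, x ∈ Set.Icc (0 : ℝ) 1 := by
  rw [betaOrderLaw_eq hℓ hℓn]
  refine (withDensity_absolutelyContinuous _ _).ae_le ?_
  filter_upwards [ae_restrict_mem measurableSet_Ioo] with x hx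
  exact Set.Ioo_subset_Icc_self hx

lemma betaOrderLaw_real_Iio {n ℓ : ℕ} (hℓ : 1 ≤ ℓ) (hℓn : ℓ ≤ n) {t : ℝ}
    (h0 : 0 ≤ t) (h1 : t ≤ 1) :
    (betaOrderLaw n ℓ).real (Set.Iio t) = 1 - binomTail n ℓ t := by
  have hset : Set.Iio t ∩ Set.Ioo 0 1 = Set.Ioo 0 t := by
    ext x
    simp only [Set.mem_inter_iff, Set.mem_Iio, Set.mem_Ioo]
    constructor
    · rintro ⟨h, h', -⟩; exact ⟨h', h⟩
    · rintro ⟨h, h'⟩; exact ⟨h', h, h'.trans_le h1⟩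
  rw [measureReal_def, betaOrderLaw_eq hℓ hℓn, withDensity_apply _ measurableSet_Iio,
    Measure.restrict_restrict measurableSet_Iio, hset,
    ← integral_eq_lintegral_of_nonneg_ae
      (ae_restrict_of_forall_mem measurableSet_Ioo fun x hx =>
        orderDensity_nonneg n ℓ hx.1.le (hx.2.le.trans h1))
      (continuous_orderDensity n ℓ).aestronglyMeasurable,
    ← integral_Ioc_eq_integral_Ioo, ← intervalIntegral.integral_of_le h0,
    intervalIntegral.integral_eq_sub_of_hasDerivAt (f := fun x => -binomTail n ℓ x)
      (fun x _ => by simpa using (hasDerivAt_binomTail n ℓ x).fun_neg)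
      ((continuous_orderDensity n ℓ).intervalIntegrable _ _), binomTail_zero n hℓ]
  ring

lemma cdf_betaOrderLaw {n ℓ : ℕ} (hℓ : 1 ≤ ℓ) (hℓn : ℓ ≤ n) {t : ℝ}
    (h0 : 0 ≤ t) (h1 : t ≤ 1) :
    cdf (betaOrderLaw n ℓ) t = 1 - binomTail n ℓ t := by
  have := isProbabilityMeasure_betaOrderLaw hℓ hℓn
  have hac : betaOrderLaw n ℓ ≪ volume := withDensity_absolutelyContinuous _ _
  rw [cdf_eq_real, ← betaOrderLaw_real_Iio hℓ hℓn h0 h1, 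
    measureReal_congr (hac.ae_eq Iio_ae_eq_Iic)]

lemma quantileFn_betaOrderLaw {n ℓ : ℕ} (hℓ : 1 ≤ ℓ) (hℓn : ℓ ≤ n) {c p : ℝ}
    (h0 : 0 < c) (h1 : c < 1) (hp : 0 < p) (hc : 1 - binomTail n ℓ c = p) :
    quantileFn (betaOrderLaw n ℓ) p = c := by
  refine IsLeast.csInf_eq ⟨?_, fun x hx => ?_⟩
  · rw [Set.mem_ofPred_eq, cdf_betaOrderLaw hℓ hℓn h0.le h1.le, hc]
  · rw [Set.mem_ofPred_eq] at hx
    by_contra! hxc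
    have hz : cdf (betaOrderLaw n ℓ) 0 = 0 := by
      rw [cdf_betaOrderLaw hℓ hℓn le_rfl zero_le_one, binomTail_zero n hℓ, sub_self]
    -- Strict monotonicity is available only on [0,1]; for x ≤ 0 the cdf is at most its value 0 at
    -- the origin, hence below p.
    rcases le_or_gt x 0 with hx0 | hx0
    · have := monotone_cdf (betaOrderLaw n ℓ) hx0
      linarith
    · have := strictAntiOn_binomTail hℓ hℓn ⟨hx0.le, by linarith⟩ ⟨h0.le, h1.le⟩ hxc
      rw [cdf_betaOrderLaw hℓ hℓn hx0.le (by linarith)] at hx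
      linarith

lemma exists_one_sub_binomTail_eq {n ℓ : ℕ} (hℓ : 1 ≤ ℓ) (hℓn : ℓ ≤ n) {p : ℝ}
    (h0 : 0 < p) (h1 : p < 1) : ∃ c, 0 < c ∧ c < 1 ∧ 1 - binomTail n ℓ c = p := by
  have h := intermediate_value_Ioo (zero_le_one (α := ℝ))
    (continuous_one_sub_binomTail n ℓ).continuousOn
  simp only [binomTail_zero n hℓ, binomTail_one hℓn, sub_self, sub_zero] at h
  obtain ⟨c, hc, rfl⟩ := h ⟨h0, h1⟩
  exact ⟨c, hc.1, hc.2, rfl⟩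

/-! ### Order statistics of an i.i.d. sample. -/

lemma le_orderStat_iff {N : ℕ} (x : Fin N → ℝ) (r : Fin N) (t : ℝ) :
    t ≤ orderStat x r ↔ (Finset.univ.filter fun i => x i < t).card ≤ r := by
  have hmono := Tuple.monotone_sort x
  have hcard : (Finset.univ.filter fun i => x i < t).card =
      (Finset.univ.filter fun i => x (Tuple.sort x i) < t).card :=
    (Finset.card_equiv (Tuple.sort x) (by simp)).symm
  rw [hcard, orderStat]
  constructor
  · intro h
    rw [← Fin.card_Iio r]
    refine Finset.card_le_card fun i hi => ?_
    rw [Finset.mem_filter] at hi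
    rw [Finset.mem_Iio]
    by_contra! hri
    exact absurd (hmono hri) (by simp only [Function.comp]; linarith [hi.2])
  · contrapose!
    intro h
    rw [← Nat.add_one_le_iff, ← Fin.card_Iic r]
    refine Finset.card_le_card fun i hi => ?_
    rw [Finset.mem_Iic] at hi
    rw [Finset.mem_filter]
    exact ⟨Finset.mem_univ _, (hmono hi).trans_lt h⟩

/-- The event is split by the set s of indices whose values lie below t; the resulting boxes are
disjoint and have product measure. -/
lemma setOf_le_orderStat {N : ℕ} (r : Fin N) (t : ℝ) :
    {x : Fin N → ℝ | t ≤ orderStat x r} =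
      ⋃ s ∈ (Finset.univ : Finset (Fin N)).powerset.filter (fun s => s.card ≤ (r : ℕ)),
        Set.univ.pi fun i => if i ∈ s then Set.Iio t else Set.Ici t := by
  ext x
  simp only [Set.mem_ofPred_eq, le_orderStat_iff, Set.mem_iUnion, Finset.mem_filter,
    Set.mem_univ_pi, exists_prop]
  constructor
  · intro h
    refine ⟨Finset.univ.filter fun i => x i < t, ⟨by simp, h⟩, fun i => ?_⟩
    by_cases hi : x i < t
    · simp [hi]
    · simp [hi, not_lt.1 hi]
  · rintro ⟨s, ⟨-, hs⟩, h⟩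
    refine (Finset.card_le_card fun i hi => ?_).trans hs
    by_contra hne
    have := h i
    rw [if_neg hne] at this
    exact absurd (Finset.mem_filter.1 hi).2 (not_lt.2 this)

lemma measurableSet_pi_ite {N : ℕ} (s : Finset (Fin N)) (t : ℝ) :
    MeasurableSet (Set.univ.pi fun i => if i ∈ s then Set.Iio t else Set.Ici t) := by
  refine MeasurableSet.univ_pi fun i => ?_
  split_ifs
  exacts [measurableSet_Iio, measurableSet_Ici]

lemma measurable_orderStat {N : ℕ} (r : Fin N) :
    Measurable fun x : Fin N → ℝ => orderStat x r := by
  refine measurable_of_Ici fun t => ?_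
  change MeasurableSet {x : Fin N → ℝ | t ≤ orderStat x r}
  rw [setOf_le_orderStat]
  exact Finset.measurableSet_biUnion _ fun s _ => measurableSet_pi_ite s t

/-- The survival function of an order statistic of an i.i.d. sample is a binomial tail. -/
lemma pi_real_le_orderStat {N : ℕ} (μ : Measure ℝ) [IsProbabilityMeasure μ] (r : Fin N) (t : ℝ) :
    (Measure.pi fun _ : Fin N => μ).real {x | t ≤ orderStat x r} =
      binomTail N (r + 1) (μ.real (Set.Iio t)) := by
  have hbox : ∀ s : Finset (Fin N), (Measure.pi fun _ : Fin N => μ).real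
      (Set.univ.pi fun i => if i ∈ s then Set.Iio t else Set.Ici t) =
      μ.real (Set.Iio t) ^ s.card * (1 - μ.real (Set.Iio t)) ^ (N - s.card) := by
    intro s
    have hc : μ.real (Set.Ici t) = 1 - μ.real (Set.Iio t) := by
      rw [← Set.compl_Iio, probReal_compl_eq_one_sub measurableSet_Iio]
    have hprod : ∀ i, μ.real (if i ∈ s then Set.Iio t else Set.Ici t) =
        if i ∈ s then μ.real (Set.Iio t) else μ.real (Set.Ici t) := by
      intro i; split_ifs <;> rfl
    rw [measureReal_def, Measure.pi_pi, ENNReal.toReal_prod]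
    simp only [← measureReal_def, hprod, hc]
    rw [Finset.prod_ite]
    have hs : Finset.univ.filter (fun i => i ∉ s) = sᶜ := by ext; simp
    simp [hs, Finset.card_compl]
  rw [setOf_le_orderStat, measureReal_biUnion_finset]
  · simp only [hbox]
    rw [Finset.sum_filter, Finset.sum_powerset_apply_card (fun j =>
      if j ≤ (r : ℕ) then μ.real (Set.Iio t) ^ j * (1 - μ.real (Set.Iio t)) ^ (N - j) else 0),
      Finset.card_univ, Fintype.card_fin, binomTail]
    have hr := r.isLt
    rw [← Finset.sum_subset (Finset.range_subset_range.2 (show (r : ℕ) + 1 ≤ N + 1 by omega))]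
    · refine Finset.sum_congr rfl fun j hj => ?_
      rw [if_pos (by have := Finset.mem_range.1 hj; omega), nsmul_eq_mul, mul_assoc]
    · intro j _ hj
      rw [if_neg (by rw [Finset.mem_range] at hj; omega), smul_zero]
  · intro s _ s' _ hne
    refine Set.disjoint_left.2 fun x hx hx' => hne ?_
    ext i
    have h1 := hx i trivial
    have h2 := hx' i trivial
    by_cases hs : i ∈ s <;> by_cases hs' : i ∈ s' <;> simp_all
    · exact absurd h1 (not_lt.2 h2)
    · exact absurd h2 (not_lt.2 h1)
  · exact fun s _ => measurableSet_pi_ite s t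

/-- Layer-cake formula for a variable with values in [0,1]; the shift r + 1 comes from indices
starting at 0. -/
lemma integral_orderStat_betaOrderLaw {n ℓ : ℕ} (hℓ : 1 ≤ ℓ) (hℓn : ℓ ≤ n) {m : ℕ} (r : Fin m) :
    ∫ x : Fin m → ℝ, orderStat x r ∂(Measure.pi fun _ : Fin m => betaOrderLaw n ℓ) =
      ∫ t in (0 : ℝ)..1, binomTail m (r + 1) (1 - binomTail n ℓ t) := by
  have := isProbabilityMeasure_betaOrderLaw hℓ hℓn
  have hmem : ∀ᵐ x ∂(Measure.pi fun _ : Fin m => betaOrderLaw n ℓ),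
      ∀ i, x i ∈ Set.Icc (0 : ℝ) 1 :=
    ae_all_iff.2 fun i =>
      (measurePreserving_eval (fun _ : Fin m => betaOrderLaw n ℓ) i).quasiMeasurePreserving.ae
        (ae_betaOrderLaw_mem hℓ hℓn)
  have h0 : ∀ᵐ x ∂(Measure.pi fun _ : Fin m => betaOrderLaw n ℓ), 0 ≤ orderStat x r :=
    hmem.mono fun x hx => (hx _).1
  have h1 : ∀ᵐ x ∂(Measure.pi fun _ : Fin m => betaOrderLaw n ℓ), orderStat x r ≤ 1 :=
    hmem.mono fun x hx => (hx _).2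
  have hint : Integrable (fun x : Fin m → ℝ => orderStat x r)
      (Measure.pi fun _ : Fin m => betaOrderLaw n ℓ) := by
    refine Integrable.of_bound (measurable_orderStat r).aestronglyMeasurable 1 ?_
    filter_upwards [h0, h1] with x hx0 hx1
    rwa [Real.norm_of_nonneg hx0]
  rw [hint.integral_eq_integral_Ioc_meas_le h0 h1, intervalIntegral.integral_of_le zero_le_one]
  refine setIntegral_congr_fun measurableSet_Ioc fun t ht => ?_
  simp only [pi_real_le_orderStat, betaOrderLaw_real_Iio hℓ hℓn ht.1.le ht.2]

/-! ### The closed form of the mean, and the conclusion. -/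

lemma coverageM_eq_integral {n m ℓ k : ℕ} (hℓ : 1 ≤ ℓ) (hℓn : ℓ ≤ n) (hk : 1 ≤ k) (hkm : k ≤ m) :
    coverageM n m ℓ k = ∫ t in (0 : ℝ)..1, binomTail m k (1 - binomTail n ℓ t) := by
  have hF : ∀ t, HasDerivAt (fun t => 1 - binomTail n ℓ t) (orderDensity n ℓ t) t := fun t => by
    simpa using (hasDerivAt_binomTail n ℓ t).const_sub 1
  have hFc := continuous_one_sub_binomTail n ℓ
  have hfc := continuous_orderDensity n ℓ
  -- The boundary terms vanish: `binomTail m k 1 = 0` at t = 1, and v = 0 at t = 0.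
  have hparts := intervalIntegral.integral_mul_deriv_eq_deriv_mul (a := 0) (b := 1)
    (u := fun t => binomTail m k (1 - binomTail n ℓ t)) (v := fun t => t)
    (u' := fun t => -orderDensity m k (1 - binomTail n ℓ t) * orderDensity n ℓ t)
    (v' := fun _ => 1)
    (fun t _ => (hasDerivAt_binomTail m k _).comp t (hF t)) (fun t _ => hasDerivAt_id t)
    (((continuous_orderDensity m k).comp hFc).neg.mul hfc |>.intervalIntegrable _ _)
    intervalIntegrable_const
  simp only [mul_one, mul_zero, sub_zero, zero_sub, binomTail_one hℓn, binomTail_one hkm,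
    ← intervalIntegral.integral_neg] at hparts
  have hexp : ∀ t : ℝ, -(-orderDensity m k (1 - binomTail n ℓ t) * orderDensity n ℓ t * t) =
      (k * (m.choose k : ℝ) * (ℓ * (n.choose ℓ : ℝ))) *
      ∑ a ∈ Fintype.piFinset (fun _ : Fin (k - 1) => Finset.Icc ℓ n),
        ∑ b ∈ Fintype.piFinset (fun _ : Fin (m - k) => Finset.range ℓ),
          ((∏ j, (n.choose (a j) : ℝ)) * ∏ j, (n.choose (b j) : ℝ)) *
            (t ^ ((∑ j, a j) + ℓ + ∑ j, b j) *
              (1 - t) ^ (m * n - ((∑ j, a j) + ℓ + ∑ j, b j))) := by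
    intro t
    have e1 : (1 - binomTail n ℓ t) ^ (k - 1) =
        ∑ a ∈ Fintype.piFinset (fun _ : Fin (k - 1) => Finset.Icc ℓ n),
          ∏ j, ((n.choose (a j) : ℝ) * t ^ a j * (1 - t) ^ (n - a j)) := by
      rw [← Finset.prod_univ_sum (fun _ => Finset.Icc ℓ n)
        (fun _ i => (n.choose i : ℝ) * t ^ i * (1 - t) ^ (n - i))]
      rw [← eq_sub_of_add_eq' (binomTail_add_sum_Icc n hℓn t), Finset.prod_const,
        Finset.card_univ, Fintype.card_fin]
    have e2 : (binomTail n ℓ t) ^ (m - k) =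
        ∑ b ∈ Fintype.piFinset (fun _ : Fin (m - k) => Finset.range ℓ),
          ∏ j, ((n.choose (b j) : ℝ) * t ^ b j * (1 - t) ^ (n - b j)) := by
      rw [← Finset.prod_univ_sum (fun _ => Finset.range ℓ)
        (fun _ i => (n.choose i : ℝ) * t ^ i * (1 - t) ^ (n - i))]
      simp [binomTail]
    rw [orderDensity, orderDensity, sub_sub_cancel, e1, e2]
    -- The factor t from the integration by parts raises t^(ℓ-1) to t^ℓ, whence the lone ℓ in the
    -- lower binomial index.
    rw [show ∀ x y z w A B C : ℝ, -(-(x * y * A * B) * (z * w * t ^ (ℓ - 1) * C) * t) =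
      (x * y * (z * w)) * ((A * B) * (t ^ (ℓ - 1) * t * C)) by intros; ring, ← pow_succ,
      Nat.sub_add_cancel hℓ, Finset.sum_mul_sum]
    congr 1
    rw [Finset.sum_mul]
    refine Finset.sum_congr rfl fun a ha => ?_
    rw [Finset.sum_mul]
    refine Finset.sum_congr rfl fun b hb => ?_
    have ha' : ∀ j, a j ≤ n := fun j => (Finset.mem_Icc.1 (Fintype.mem_piFinset.1 ha j)).2
    have hb' : ∀ j, b j ≤ n := fun j =>
      (Finset.mem_range.1 (Fintype.mem_piFinset.1 hb j)).le.trans hℓn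
    have hexpo : m * n - ((∑ j, a j) + ℓ + ∑ j, b j) =
        (∑ j, (n - a j)) + (∑ j, (n - b j)) + (n - ℓ) := by
      have s1 : ∑ j, (n - a j) + ∑ j, a j = (k - 1) * n := by
        rw [← Finset.sum_add_distrib]
        simp [Nat.sub_add_cancel (ha' _)]
      have s2 : ∑ j, (n - b j) + ∑ j, b j = (m - k) * n := by
        rw [← Finset.sum_add_distrib]
        simp [Nat.sub_add_cancel (hb' _)]
      have s3 : m * n = (k - 1) * n + (m - k) * n + n := by
        rw [← add_mul, ← Nat.succ_mul]; congr 1; omega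
      omega
    rw [hexpo]
    simp only [Finset.prod_mul_distrib, Finset.prod_pow_eq_pow_sum, pow_add]
    ring
  simp only [hexp, intervalIntegral.integral_const_mul] at hparts
  rw [hparts, coverageM, beta_natCast hℓ hℓn]
  rw [intervalIntegral.integral_finsetSum fun a _ => by
    apply Continuous.intervalIntegrable; fun_prop]
  have hsum : ∀ a ∈ Fintype.piFinset (fun _ : Fin (k - 1) => Finset.Icc ℓ n),
      (∫ t in (0 : ℝ)..1, ∑ b ∈ Fintype.piFinset (fun _ : Fin (m - k) => Finset.range ℓ),
          ((∏ j, (n.choose (a j) : ℝ)) * ∏ j, (n.choose (b j) : ℝ)) *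
            (t ^ ((∑ j, a j) + ℓ + ∑ j, b j) *
              (1 - t) ^ (m * n - ((∑ j, a j) + ℓ + ∑ j, b j)))) =
      (1 / ((m : ℝ) * n + 1)) *
        ∑ b ∈ Fintype.piFinset (fun _ : Fin (m - k) => Finset.range ℓ),
          ((∏ j, (n.choose (a j) : ℝ)) * ∏ j, (n.choose (b j) : ℝ)) /
            ((m * n).choose ((∑ j, a j) + ℓ + ∑ j, b j) : ℝ) := by
    intro a ha
    rw [intervalIntegral.integral_finsetSum fun b _ => by
      apply Continuous.intervalIntegrable; fun_prop, Finset.mul_sum]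
    refine Finset.sum_congr rfl fun b hb => ?_
    have hle : (∑ j, a j) + ℓ + ∑ j, b j ≤ m * n := by
      have s1 : ∑ j, a j ≤ (k - 1) * n := by
        simpa using Finset.sum_le_card_nsmul Finset.univ a n fun j _ =>
          (Finset.mem_Icc.1 (Fintype.mem_piFinset.1 ha j)).2
      have s2 : ∑ j, b j ≤ (m - k) * n := by
        simpa using Finset.sum_le_card_nsmul Finset.univ b n fun j _ =>
          (Finset.mem_range.1 (Fintype.mem_piFinset.1 hb j)).le.trans hℓn
      have s3 : m * n = (k - 1) * n + (m - k) * n + n := by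
        rw [← add_mul, ← Nat.succ_mul]; congr 1; omega
      omega
    rw [intervalIntegral.integral_const_mul, integral_pow_mul_one_sub_pow hle]
    push_cast
    rw [one_div_mul_eq_div, div_div, mul_one_div, mul_comm (((m : ℝ) * n + 1))]
  rw [Finset.sum_congr rfl hsum, ← Finset.mul_sum]
  have p1 : (ℓ * (n.choose ℓ : ℝ)) ≠ 0 := by
    have := Nat.choose_pos hℓn
    positivity
  have p2 : (m : ℝ) * n + 1 ≠ 0 := by positivity
  generalize (∑ a ∈ Fintype.piFinset (fun _ : Fin (k - 1) => Finset.Icc ℓ n), _ : ℝ) = S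
  field_simp

theorem mainTheorem5 (n m ℓ k : ℕ) (hℓ : 1 ≤ ℓ) (hℓn : ℓ ≤ n) (hk : 1 ≤ k) (hkm : k ≤ m) :
    coverageM n m ℓ k =
        ∫ x : Fin m → ℝ, orderStat x ⟨k - 1, by omega⟩
          ∂(Measure.pi fun _ : Fin m => betaOrderLaw n ℓ) ∧
      quantileFn (betaOrderLaw n ℓ) (((k : ℝ) - 1 / 2) / ((m : ℝ) + 1 / 2)) <
        coverageM n m ℓ k ∧
      coverageM n m ℓ k <
        quantileFn (betaOrderLaw n ℓ) ((k : ℝ) / ((m : ℝ) + 1 / 2)) := by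
  have hk' : (1 : ℝ) ≤ k := by exact_mod_cast hk
  have hkm' : (k : ℝ) ≤ m := by exact_mod_cast hkm
  have hm : (0 : ℝ) < m + 1 / 2 := by positivity
  have hF : ∀ t, HasDerivAt (fun t => 1 - binomTail n ℓ t) (orderDensity n ℓ t) t := fun t => by
    simpa using (hasDerivAt_binomTail n ℓ t).const_sub 1
  have hF0 : 1 - binomTail n ℓ 0 = 0 := by rw [binomTail_zero n hℓ, sub_self]
  have hF1 : 1 - binomTail n ℓ 1 = 1 := by rw [binomTail_one hℓn, sub_zero]
  have hpos : ∀ t, 0 < t → t < 1 → 0 < orderDensity n ℓ t := fun t h0 h1 =>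
    orderDensity_pos hℓ hℓn h0 h1
  have hnn : ∀ t, 0 ≤ t → t ≤ 1 → 0 ≤ orderDensity n ℓ t := fun t h0 h1 =>
    orderDensity_nonneg n ℓ h0 h1
  rw [coverageM_eq_integral hℓ hℓn hk hkm]
  refine ⟨?_, ?_, ?_⟩
  · rw [integral_orderStat_betaOrderLaw hℓ hℓn]
    simp only [Nat.sub_add_cancel hk]
  · have hp0 : 0 < ((k : ℝ) - 1 / 2) / (m + 1 / 2) := div_pos (by linarith) hm
    obtain ⟨c, hc0, hc1, hc⟩ := exists_one_sub_binomTail_eq hℓ hℓn hp0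
      ((div_lt_one hm).2 (by linarith))
    rw [quantileFn_betaOrderLaw hℓ hℓn hc0 hc1 hp0 hc]
    exact lt_integral_binomTail_comp hk hkm hF (continuous_orderDensity n ℓ) hF0 hF1 hpos hnn
      (fun s t h0 h1 h2 => orderDensity_mul_one_sub_binomTail_le n ℓ h0 h1 h2 hℓ hℓn) hc0 hc1 hc
  · have hp0 : 0 < (k : ℝ) / (m + 1 / 2) := div_pos (by linarith) hm
    obtain ⟨c, hc0, hc1, hc⟩ := exists_one_sub_binomTail_eq hℓ hℓn hp0
      ((div_lt_one hm).2 (by linarith))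
    rw [quantileFn_betaOrderLaw hℓ hℓn hc0 hc1 hp0 hc]
    exact integral_binomTail_comp_lt hk hkm hF (continuous_orderDensity n ℓ) hF0 hF1 hpos hnn
      (fun s t h0 h1 h2 => by
        simpa using orderDensity_mul_binomTail_le n ℓ h0 h1 h2 hℓn) hc0 hc1 hc
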